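/- **Setting.** Let $O\subseteq\mathbb R^n$ be open (a coordinate chart). A deformation on $O$ is given by smooth functions $H^m(x,\tilde t)$, defined for $x\in O$, $x+\tilde t\in O$, with $H^m(x,0)=0$, for which there are smooth functions $K^\mu(x,t)$, defined on the values $t=H(x,\tilde t)$, with $K(x,H(x,\tilde t))=\tilde t$. Put $h(x)^\mu_m=\partial_{t^m}K^\mu(x,t)|_{t=0}$, let $H^\mu(x,\tilde t)=h(x)^\mu_m H^m(x,\tilde t)$ be the deformation functions in the coordinate basis, and let $\Gamma(x)^\mu_{\sigma\nu}=\partial^2H^\mu(x,\tilde t)/\partial\tilde t^\sigma\partial\tilde t^\nu|_{\tilde t=0}$. A curve $x(s)$, $s\in[0,T]$, $T>0$, in $O$ with velocity $\tau=\dot x$ satisfies the canonicity condition if $$\tau^\mu(s)=\frac{\partial H^\mu}{\partial\tilde t^\nu}\bigl(x(s),x(s')-x(s)\bigr)\,\tau^\nu(s')\qquad\text{for all } s,s'\in[0,T].\tag{14}$$ The deformation is canonical if any two points of $O$ are joined by at least one curve in $O$ satisfying (14). A geodesic of $\Gamma$ in affine parameterization is a curve in $O$ with $\dot x=\tau$,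 $\dot\tau^\mu+\Gamma(x)^\mu_{\sigma\nu}\tau^\sigma\tau^\nu=0$. **Proposition 1 (uniqueness of canonical deformations).** (a) $\Gamma$ is smooth and symmetric in its lower indices, i.e. it gives a torsion-free affine connection on $O$. Every curve satisfying (14) is a geodesic of $\Gamma$ in affine parameterization. Between two given points $x,x'\in O$ there is, up to the affine change of parameter that rescales $[0,T]$, at most one curve in $O$ satisfying (14); if the deformation is canonical, this curve is also the only geodesic of $\Gamma$ contained in $O$ that joins $x$ to $x'$, up to the same change of parameter. (b) If two canonical deformations on $O$ have the same connection coefficients $\Gamma$ on $O$, then their deformation functions in the coordinate basis $H^\mu(x,\tilde t)$ coincide for all $x\in O$, $x+\tilde t\in O$. For a canonical deformation, the derivatives of the deformation functions along geodesics are first integrals of the geodesic equations on the geodesics through the base point: for every geodesic $x(s)$, $s\in[0,T]$, in $O$ and all $s_0,s\in[0,T]$, $$\frac{d}{ds}H^\mu\bigl(x(s_0),x(s)-x(s_0)\bigr)=\frac{\partial H^\mu}{\partial\tilde t^\nu}\bigl(x(s_0),x(s)-x(s_0)\bigr)\,\tau^\nu(s)=\tau^\mu(s_0),$$ which does not depend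 on $s$; and these $n$ first integrals are independent, the matrix $\partial_{\tilde\nu}H^\mu(x,x'-x)$ being invertible for all $x,x'\in O$. -/

import Mathlib

open Set
open scoped ContDiff

/-- A deformation over the coordinate chart `O ⊆ ℝⁿ`. The deformation functions `H x s = H^m(x, s)`
take as arguments a point `x ∈ O` and the value `s` at `x` of a (local) shift `s̃(x)`, so that
`x + s ∈ O`; the functions `K x t = K^μ(x, t)` specify the reverse transition, and need only be
defined for values `t` of parameters of the deformed group. -/
structure Deformation {n : ℕ} (O : Set (Fin n → ℝ)) where
  /-- the deformation functions `H^m(x, s)` -/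
  H : (Fin n → ℝ) → (Fin n → ℝ) → (Fin n → ℝ)
  /-- the reverse functions `K^μ(x, t)` -/
  K : (Fin n → ℝ) → (Fin n → ℝ) → (Fin n → ℝ)
  smooth_H : ContDiffOn ℝ ∞ (fun p : (Fin n → ℝ) × (Fin n → ℝ) => H p.1 p.2)
    {p | p.1 ∈ O ∧ p.1 + p.2 ∈ O}
  smooth_K : ContDiffOn ℝ ∞ (fun p : (Fin n → ℝ) × (Fin n → ℝ) => K p.1 p.2)
    {p | p.1 ∈ O ∧ ∃ s, p.1 + s ∈ O ∧ H p.1 s = p.2}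
  H_zero : ∀ x ∈ O, H x 0 = 0
  K_H : ∀ x ∈ O, ∀ s, x + s ∈ O → K x (H x s) = s

namespace Deformation

variable {n : ℕ} {O : Set (Fin n → ℝ)}

/-- The affine vielbein `h(x)^μ_m = ∂_m K^μ(x, t)` at `t = 0`. -/
noncomputable def vielbein (D : Deformation O) (x : Fin n → ℝ) :
    (Fin n → ℝ) →L[ℝ] (Fin n → ℝ) :=
  fderiv ℝ (D.K x) 0

/-- The deformation functions in the coordinate basis, `H^μ(x, s) = h(x)^μ_m H^m(x, s)`. -/
noncomputable def coordH (D : Deformation O) (x s : Fin n → ℝ) : Fin n → ℝ :=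
  D.vielbein x (D.H x s)

/-- The matrix `∂_{s^ν} H^μ(x, s)` at `s = x' - x`, which transports vectors from `x'` to `x`. -/
noncomputable def transport (D : Deformation O) (x x' : Fin n → ℝ) :
    (Fin n → ℝ) →L[ℝ] (Fin n → ℝ) :=
  fderiv ℝ (D.coordH x) (x' - x)

/-- The connection coefficients `Γ(x)^μ_{σν} = ∂²H^μ(x, s) / ∂s^σ ∂s^ν` at `s = 0`, as the bilinear
map `(u, v) ↦ Γ(x)^μ_{σν} u^σ v^ν`. -/
noncomputable def Gam (D : Deformation O) (x : Fin n → ℝ) :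
    (Fin n → ℝ) →L[ℝ] (Fin n → ℝ) →L[ℝ] (Fin n → ℝ) :=
  fderiv ℝ (fderiv ℝ (D.coordH x)) 0

end Deformation

/-- `y` is a differentiable curve in `O`, parameterized by `[0, T]` with `T > 0`, with `y 0 = x` and
`y T = x'`, and `τ` is its velocity (one-sided at the end points). -/
structure IsCurve {n : ℕ} (O : Set (Fin n → ℝ)) (x x' : Fin n → ℝ) (T : ℝ)
    (y τ : ℝ → Fin n → ℝ) : Prop where
  pos : 0 < T
  mem : ∀ s ∈ Icc 0 T, y s ∈ O
  source : y 0 = x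
  target : y T = x'
  velocity : ∀ s ∈ Icc 0 T, HasDerivWithinAt y (τ s) (Icc 0 T) s

/-- `Γ` is a field of coefficients of a torsion-free affine connection on `O`: it is smooth and
symmetric in the lower indices. -/
structure IsTorsionFreeConnection {n : ℕ} (O : Set (Fin n → ℝ))
    (Γ : (Fin n → ℝ) → (Fin n → ℝ) →L[ℝ] (Fin n → ℝ) →L[ℝ] (Fin n → ℝ)) : Prop where
  smooth : ContDiffOn ℝ ∞ Γ O
  symm : ∀ x ∈ O, ∀ u v, Γ x u v = Γ x v u

/-- `y`, with velocity `τ`, is a geodesic in affine parameterization of the connection `Γ` in `O`,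
joining `x` to `x'`:  `τ'^μ + Γ(y)^μ_{σν} τ^σ τ^ν = 0`. -/
structure IsGeodesic {n : ℕ} (O : Set (Fin n → ℝ))
    (Γ : (Fin n → ℝ) → (Fin n → ℝ) →L[ℝ] (Fin n → ℝ) →L[ℝ] (Fin n → ℝ))
    (x x' : Fin n → ℝ) (T : ℝ) (y τ : ℝ → Fin n → ℝ) : Prop extends IsCurve O x x' T y τ where
  geodesic : ∀ s ∈ Icc 0 T, HasDerivWithinAt τ (-(Γ (y s) (τ s) (τ s))) (Icc 0 T) s

namespace Deformation

variable {n : ℕ} {O : Set (Fin n → ℝ)}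

/-- The curve `y` joins `x` to `x'` in `O`, and the condition of canonicity holds along it:
`τ^μ(s) = ∂_ν H^μ(y(s), y(s') - y(s)) τ^ν(s')` for all `s, s' ∈ [0, T]`. -/
structure CanonicalAlong (D : Deformation O) (x x' : Fin n → ℝ) (T : ℝ)
    (y τ : ℝ → Fin n → ℝ) : Prop extends IsCurve O x x' T y τ where
  canonical : ∀ s ∈ Icc 0 T, ∀ s' ∈ Icc 0 T, τ s = D.transport (y s) (y s') (τ s')

/-- A deformation is canonical if any two points of `O` are joined by at least one curve along which
the condition of canonicity holds. -/
def IsCanonical (D : Deformation O) : Prop :=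
  ∀ x ∈ O, ∀ x' ∈ O, ∃ T y τ, D.CanonicalAlong x x' T y τ

end Deformation

/-!
Fix a base point `x` and put `φ z = H(x, z - x)`. Condition (14) says that `φ` straightens a curve
from `x` to the segment `s ↦ s τ(0)`, which gives uniqueness, and differentiating (14) at `s' = s`
gives the geodesic equation.

Conversely let the deformation be canonical. Every point of `O` lies on a geodesic from `x` that `φ`
straightens, so the covariant Hessian `B` of `φ`, read in the chart `φ`, satisfies `B(u)(u, u) = 0`
at each position `u`. An arbitrary geodesic from `x` is mapped to a solution of
`u'' = B(u)(u', u')`. The deviation `w = u - s u'` from a uniform straight motion has derivative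
`-s u''`, and expanding `B(u)(u, u) = 0` around `s u'` bounds it by a multiple of `‖w‖`. By Grönwall
`w = 0`, so `φ` straightens the geodesic and (14) holds along it. Hence in a canonical deformation
geodesics satisfy (14), and `Γ` determines `H` through `H(x, x' - x) = T τ(0)`.
-/

section Calculus

open scoped Topology

theorem preimage_add_left_mem_nhds {M : Type*} [TopologicalSpace M] [Add M] [ContinuousAdd M]
    {O : Set M} (hO : IsOpen O) {x s : M} (hs : x + s ∈ O) :
    (x + ·) ⁻¹' O ∈ 𝓝 s :=
  (hO.preimage (continuous_const_add x)).mem_nhds hs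

variable {E F : Type*} [NormedAddCommGroup E] [NormedSpace ℝ E] [NormedAddCommGroup F]
  [NormedSpace ℝ F]

theorem isInvertible_of_comp_eq_id [FiniteDimensional ℝ E] {f g : E →L[ℝ] E}
    (h : g ∘L f = .id ℝ E) : f.IsInvertible := by
  refine .of_inverse (g := g) ?_ h
  ext1 v
  exact LinearMap.congr_fun ((LinearMap.comp_eq_id_comm (f := (g : E →ₗ[ℝ] E))
    (g := (f : E →ₗ[ℝ] E))).1 (LinearMap.ext fun v => DFunLike.congr_fun h v)) v

theorem isInvertible_of_leftInvOn [FiniteDimensional ℝ E] {f g : E → E} {f' : E →L[ℝ] E}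
    {U : Set E} {a : E} (hf : HasFDerivAt f f' a) (hU : U ∈ 𝓝 a)
    (hg : DifferentiableWithinAt ℝ g (f '' U) (f a)) (hgf : LeftInvOn g f U) :
    f'.IsInvertible := by
  have hcomp := (hg.hasFDerivWithinAt.comp a hf.hasFDerivWithinAt
    (mapsTo_image f U)).hasFDerivAt hU
  refine isInvertible_of_comp_eq_id (hcomp.unique ?_)
  exact (hasFDerivAt_id a).congr_of_eventuallyEq (Filter.eventuallyEq_of_mem hU hgf)

theorem eq_zero_of_hasDerivWithinAt_of_eqOn_const {I : Set ℝ} (hI : UniqueDiffOn ℝ I) {f : ℝ → E}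
    {f' c : E} {s : ℝ} (hs : s ∈ I) (hf' : HasDerivWithinAt f f' I s) (hf : ∀ r ∈ I, f r = c) :
    f' = 0 :=
  (hI s hs).eq_deriv _ hf' ((hasDerivWithinAt_const s I c).congr hf (hf s hs))

theorem eq_of_hasDerivWithinAt_zero {I : Set ℝ} (hI : Convex ℝ I) {f : ℝ → E}
    (hf : ∀ s ∈ I, HasDerivWithinAt f 0 I s) {a b : ℝ} (ha : a ∈ I) (hb : b ∈ I) : f a = f b := by
  have h := hI.norm_image_sub_le_of_norm_hasDerivWithin_le hf (fun _ _ => norm_zero.le) hb ha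
  rwa [zero_mul, norm_le_zero_iff, sub_eq_zero] at h

theorem sub_eq_smul_of_hasDerivWithinAt_const {I : Set ℝ} (hI : Convex ℝ I) {f : ℝ → E} {v : E}
    (hf : ∀ s ∈ I, HasDerivWithinAt f v I s) {a b : ℝ} (ha : a ∈ I) (hb : b ∈ I) :
    f b - f a = (b - a) • v := by
  have hlin : ∀ s ∈ I, HasDerivWithinAt (fun r => f r - r • v) 0 I s := fun s hs =>
    ((hf s hs).sub ((hasDerivWithinAt_id s I).smul_const v)).congr_deriv (by simp)
  rw [sub_smul, sub_eq_sub_iff_sub_eq_sub]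
  exact eq_of_hasDerivWithinAt_zero hI hlin hb ha

theorem eq_smul_of_norm_smul_deriv_le {T K : ℝ} {u p a : ℝ → E}
    (hu : ∀ s ∈ Icc 0 T, HasDerivWithinAt u (p s) (Icc 0 T) s)
    (hp : ∀ s ∈ Icc 0 T, HasDerivWithinAt p (a s) (Icc 0 T) s) (hu0 : u 0 = 0)
    (ha : ∀ s ∈ Icc 0 T, ‖s • a s‖ ≤ K * ‖u s - s • p s‖) {s : ℝ} (hs : s ∈ Icc 0 T) :
    u s = s • p s := by
  have hw : ∀ s ∈ Icc 0 T, HasDerivWithinAt (fun s => u s - s • p s) (-(s • a s)) (Icc 0 T) s :=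
    fun s hs => ((hu s hs).sub ((hasDerivWithinAt_id s (Icc 0 T)).smul (hp s hs))).congr_deriv
      (by simp)
  refine sub_eq_zero.1 (eq_zero_of_abs_deriv_le_mul_abs_self_of_eq_zero_right (K := K)
    (fun r hr => (hw r hr).continuousWithinAt) (fun r hr => ?_) (by simp [hu0])
    (fun r hr => (norm_neg _).trans_le (ha r (Ico_subset_Icc_self hr))) s hs)
  exact (hw r (Ico_subset_Icc_self hr)).mono_of_mem_nhdsWithin
    (Filter.mem_of_superset (Icc_mem_nhdsGE hr.2) (Icc_subset_Icc_left hr.1))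

theorem velocity_eq_of_norm_smul_deriv_le {T K : ℝ} {u p a : ℝ → E}
    (hu : ∀ s ∈ Icc 0 T, HasDerivWithinAt u (p s) (Icc 0 T) s)
    (hp : ∀ s ∈ Icc 0 T, HasDerivWithinAt p (a s) (Icc 0 T) s) (hu0 : u 0 = 0)
    (ha : ∀ s ∈ Icc 0 T, ‖s • a s‖ ≤ K * ‖u s - s • p s‖) {s : ℝ} (hs : s ∈ Icc 0 T) :
    p s = p 0 := by
  rcases (hs.1.trans hs.2).eq_or_lt with rfl | hT
  · rw [le_antisymm hs.2 hs.1]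
  have ha0 : ∀ r ∈ Ioc 0 T, a r = 0 := fun r hr => by
    have h := ha r (Ioc_subset_Icc_self hr)
    rw [eq_smul_of_norm_smul_deriv_le hu hp hu0 ha (Ioc_subset_Icc_self hr), sub_self, norm_zero,
      mul_zero, norm_le_zero_iff] at h
    exact (smul_eq_zero_iff_right hr.1.ne').1 h
  have hconst : EqOn p (fun _ => p T) (Ioc 0 T) := fun r hr =>
    eq_of_hasDerivWithinAt_zero (convex_Ioc 0 T)
      (fun r hr => ha0 r hr ▸ (hp r (Ioc_subset_Icc_self hr)).mono Ioc_subset_Icc_self) hr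
      (right_mem_Ioc.2 hT)
  have hconst' : EqOn p (fun _ => p T) (Icc 0 T) :=
    hconst.of_subset_closure (fun r hr => (hp r hr).continuousWithinAt) continuousOn_const
      Ioc_subset_Icc_self (closure_Ioc hT.ne).ge
  exact (hconst' hs).trans (hconst' (left_mem_Icc.2 hT.le)).symm

theorem norm_smul_apply_apply_self_le {B : E →L[ℝ] E →L[ℝ] F} {u p : E} {b P s : ℝ}
    (hB : ‖B‖ ≤ b) (hBu : B u u = 0) (hs : 0 ≤ s) (hu : ‖u‖ ≤ P * s) (hp : ‖p‖ ≤ P) :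
    ‖s • B p p‖ ≤ 2 * b * P * ‖u - s • p‖ := by
  have hb := (norm_nonneg B).trans hB
  have hP := (norm_nonneg p).trans hp
  rcases hs.eq_or_lt with rfl | hpos
  · rw [zero_smul, norm_zero]
    positivity
  have hsp : ‖s • p‖ ≤ P * s := by
    rw [norm_smul, Real.norm_of_nonneg hs, mul_comm]
    gcongr
  have hexpand : s • s • B p p = -(B (u - s • p) (s • p) + B u (u - s • p)) := by
    simp only [map_sub, map_smul, sub_apply, smul_apply, hBu]
    module
  refine le_of_mul_le_mul_left ?_ hpos
  calc s * ‖s • B p p‖ = ‖B (u - s • p) (s • p) + B u (u - s • p)‖ := by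
        rw [← norm_neg (_ + _), ← hexpand, norm_smul s (s • _), Real.norm_of_nonneg hs]
    _ ≤ b * ‖u - s • p‖ * (P * s) + b * (P * s) * ‖u - s • p‖ :=
        norm_add_le_of_le (B.le_of_opNorm₂_le_of_le hB le_rfl hsp)
          (B.le_of_opNorm₂_le_of_le hB hu le_rfl)
    _ = s * (2 * b * P * ‖u - s • p‖) := by ring

theorem velocity_eq_of_radial {T : ℝ} {u p : ℝ → E} {B : ℝ → E →L[ℝ] E →L[ℝ] E}
    (hB : ContinuousOn B (Icc 0 T)) (hu : ∀ s ∈ Icc 0 T, HasDerivWithinAt u (p s) (Icc 0 T) s)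
    (hp : ∀ s ∈ Icc 0 T, HasDerivWithinAt p (B s (p s) (p s)) (Icc 0 T) s) (hu0 : u 0 = 0)
    (hBu : ∀ s ∈ Icc 0 T, B s (u s) (u s) = 0) {s : ℝ} (hs : s ∈ Icc 0 T) : p s = p 0 := by
  obtain ⟨b, hb⟩ := isCompact_Icc.exists_bound_of_continuousOn (E := E →L[ℝ] E →L[ℝ] E) hB
  obtain ⟨P, hP⟩ := isCompact_Icc.exists_bound_of_continuousOn
    (fun s hs => (hp s hs).continuousWithinAt : ContinuousOn p (Icc 0 T))
  have hule : ∀ r ∈ Icc 0 T, ‖u r‖ ≤ P * r := fun r hr => by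
    have h := (convex_Icc 0 T).norm_image_sub_le_of_norm_hasDerivWithin_le hu hP
      (left_mem_Icc.2 (hr.1.trans hr.2)) hr
    rwa [hu0, sub_zero, sub_zero, Real.norm_of_nonneg hr.1] at h
  exact velocity_eq_of_norm_smul_deriv_le hu hp hu0 (fun r hr =>
    norm_smul_apply_apply_self_le (hb r hr) (hBu r hr) hr.1 (hule r hr) (hP r hr)) hs

theorem continuousOn_bilinearComp {X G : Type*} [TopologicalSpace X] [NormedAddCommGroup G]
    [NormedSpace ℝ G] {B : X → E →L[ℝ] E →L[ℝ] F} {A : X → G →L[ℝ] E} {S : Set X}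
    (hB : ContinuousOn B S) (hA : ContinuousOn A S) :
    ContinuousOn (fun x => (B x).bilinearComp (A x) (A x)) S :=
  (ContinuousLinearMap.flipₗᵢ ℝ G G F).continuous.comp_continuousOn
    (((ContinuousLinearMap.flipₗᵢ ℝ G E F).continuous.comp_continuousOn
      (hB.clm_comp hA)).clm_comp hA)

/-- The covariant Hessian `∂_σ∂_ν φ - Γ^μ_{σν} ∂_μ φ` of a vector valued function `φ` at `z`. -/
noncomputable def covariantHessian (Γ : E → E →L[ℝ] E →L[ℝ] E) (φ : E → F) (z : E) :
    E →L[ℝ] E →L[ℝ] F :=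
  fderiv ℝ (fderiv ℝ φ) z - (ContinuousLinearMap.compL ℝ E E F (fderiv ℝ φ z)) ∘L Γ z

theorem continuousOn_covariantHessian {Γ : E → E →L[ℝ] E →L[ℝ] E} {φ : E → F} {O : Set E}
    (hΓ : ContinuousOn Γ O) (hφ : ∀ z ∈ O, ContDiffAt ℝ 2 φ z) :
    ContinuousOn (covariantHessian Γ φ) O := by
  have hφ' : ∀ z ∈ O, ContDiffAt ℝ 1 (fderiv ℝ φ) z := fun z hz => (hφ z hz).fderiv_right le_rfl
  have hφ'' : ContinuousOn (fderiv ℝ (fderiv ℝ φ)) O := fun z hz =>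
    ((hφ' z hz).fderiv_right (m := 0) le_rfl).continuousAt.continuousWithinAt
  have hcomp : ContinuousOn (fun z => ContinuousLinearMap.compL ℝ E E F (fderiv ℝ φ z)) O :=
    (ContinuousLinearMap.continuous _).comp_continuousOn
      fun z hz => (hφ' z hz).continuousAt.continuousWithinAt
  exact hφ''.sub (hcomp.clm_comp hΓ)

end Calculus

namespace IsCurve

variable {n : ℕ} {O : Set (Fin n → ℝ)} {x x' : Fin n → ℝ} {T : ℝ} {y τ : ℝ → Fin n → ℝ}
  {F : Type*} [NormedAddCommGroup F] [NormedSpace ℝ F] {φ : (Fin n → ℝ) → F}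

theorem zero_mem (h : IsCurve O x x' T y τ) : (0 : ℝ) ∈ Icc 0 T := left_mem_Icc.2 h.pos.le

theorem length_mem (h : IsCurve O x x' T y τ) : T ∈ Icc 0 T := right_mem_Icc.2 h.pos.le

theorem source_mem (h : IsCurve O x x' T y τ) : x ∈ O := h.source ▸ h.mem 0 h.zero_mem

theorem continuousOn (h : IsCurve O x x' T y τ) : ContinuousOn y (Icc 0 T) :=
  fun s hs => (h.velocity s hs).continuousWithinAt

theorem hasDerivWithinAt_comp (h : IsCurve O x x' T y τ) {s : ℝ} (hs : s ∈ Icc 0 T)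
    (hφ : DifferentiableAt ℝ φ (y s)) :
    HasDerivWithinAt (fun r => φ (y r)) (fderiv ℝ φ (y s) (τ s)) (Icc 0 T) s :=
  hφ.hasFDerivAt.comp_hasDerivWithinAt s (h.velocity s hs)

theorem hasDerivWithinAt_fderiv_velocity (h : IsCurve O x x' T y τ) {s : ℝ} (hs : s ∈ Icc 0 T)
    (hφ : ContDiffAt ℝ 2 φ (y s)) {a : Fin n → ℝ} (ha : HasDerivWithinAt τ a (Icc 0 T) s) :
    HasDerivWithinAt (fun r => fderiv ℝ φ (y r) (τ r))
      (fderiv ℝ (fderiv ℝ φ) (y s) (τ s) (τ s) + fderiv ℝ φ (y s) a) (Icc 0 T) s :=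
  (h.hasDerivWithinAt_comp hs ((hφ.fderiv_right le_rfl).differentiableAt one_ne_zero)).clm_apply ha

theorem comp_eq_smul (h : IsCurve O x x' T y τ) (hφ : ∀ z ∈ O, DifferentiableAt ℝ φ z)
    (hφx : φ x = 0) {v : F} (hv : ∀ s ∈ Icc 0 T, fderiv ℝ φ (y s) (τ s) = v) {s : ℝ}
    (hs : s ∈ Icc 0 T) : φ (y s) = s • v := by
  have hderiv : ∀ r ∈ Icc 0 T, HasDerivWithinAt (fun r => φ (y r)) v (Icc 0 T) r := fun r hr =>
    hv r hr ▸ h.hasDerivWithinAt_comp hr (hφ _ (h.mem r hr))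
  simpa [h.source, hφx] using
    sub_eq_smul_of_hasDerivWithinAt_const (convex_Icc 0 T) hderiv h.zero_mem hs

end IsCurve

namespace IsGeodesic

variable {n : ℕ} {O : Set (Fin n → ℝ)}
  {Γ Γ' : (Fin n → ℝ) → (Fin n → ℝ) →L[ℝ] (Fin n → ℝ) →L[ℝ] (Fin n → ℝ)}
  {x x' : Fin n → ℝ} {T : ℝ} {y τ : ℝ → Fin n → ℝ}
  {F : Type*} [NormedAddCommGroup F] [NormedSpace ℝ F] {φ : (Fin n → ℝ) → F}

theorem congr (h : IsGeodesic O Γ x x' T y τ) (hΓ : ∀ z ∈ O, Γ z = Γ' z) :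
    IsGeodesic O Γ' x x' T y τ where
  toIsCurve := h.toIsCurve
  geodesic s hs := hΓ _ (h.mem s hs) ▸ h.geodesic s hs

theorem comp_lineMap (h : IsGeodesic O Γ x x' T y τ) {a b : ℝ} (ha : a ∈ Icc 0 T)
    (hb : b ∈ Icc 0 T) :
    IsGeodesic O Γ (y a) (y b) 1 (fun r => y (AffineMap.lineMap a b r))
      (fun r => (b - a) • τ (AffineMap.lineMap a b r)) := by
  have hmaps : MapsTo (AffineMap.lineMap a b) (Icc (0 : ℝ) 1) (Icc 0 T) :=
    (convex_Icc 0 T).mapsTo_lineMap ha hb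
  refine ⟨⟨one_pos, fun r hr => h.mem _ (hmaps hr), by simp, by simp, fun r hr => ?_⟩,
    fun r hr => ?_⟩
  · exact (h.velocity _ (hmaps hr)).scomp r AffineMap.hasDerivWithinAt_lineMap hmaps
  · refine (((h.geodesic _ (hmaps hr)).scomp r AffineMap.hasDerivWithinAt_lineMap
      hmaps).const_smul (b - a)).congr_deriv ?_
    simp only [map_smul, smul_apply, smul_neg]

theorem hasDerivWithinAt_fderiv_velocity (h : IsGeodesic O Γ x x' T y τ) {s : ℝ}
    (hs : s ∈ Icc 0 T) (hφ : ContDiffAt ℝ 2 φ (y s)) :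
    HasDerivWithinAt (fun r => fderiv ℝ φ (y r) (τ r))
      (covariantHessian Γ φ (y s) (τ s) (τ s)) (Icc 0 T) s :=
  (h.toIsCurve.hasDerivWithinAt_fderiv_velocity hs hφ (h.geodesic s hs)).congr_deriv <| by
    rw [map_neg, ← sub_eq_add_neg]
    rfl

theorem fderiv_velocity_eq_of_radial (h : IsGeodesic O Γ x x' T y τ) (hΓ : ContinuousOn Γ O)
    (hφ : ∀ z ∈ O, ContDiffAt ℝ 2 φ z) (hφ' : ∀ z ∈ O, (fderiv ℝ φ z).IsInvertible)
    (hφx : φ x = 0)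
    (hradial : ∀ z ∈ O, ∀ w, fderiv ℝ φ z w = φ z → covariantHessian Γ φ z w w = 0) {s : ℝ}
    (hs : s ∈ Icc 0 T) : fderiv ℝ φ (y s) (τ s) = fderiv ℝ φ x (τ 0) := by
  set A : ℝ → F →L[ℝ] Fin n → ℝ := fun r => (fderiv ℝ φ (y r)).inverse
  have hA : ContinuousOn A (Icc 0 T) := fun r hr =>
    (((hφ' _ (h.mem r hr)).contDiffAt_map_inverse (n := 0)).continuousAt.comp
      ((hφ _ (h.mem r hr)).continuousAt_fderiv two_ne_zero)).comp_continuousWithinAt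
        (h.continuousOn r hr)
  have hHess : ContinuousOn (fun r => covariantHessian Γ φ (y r)) (Icc 0 T) :=
    (continuousOn_covariantHessian hΓ hφ).comp h.continuousOn h.mem
  have hvel := velocity_eq_of_radial (u := fun r => φ (y r)) (continuousOn_bilinearComp hHess hA)
    (fun r hr => h.hasDerivWithinAt_comp hr ((hφ _ (h.mem r hr)).differentiableAt two_ne_zero))
    (fun r hr => ?_) (h.source ▸ hφx)
    (fun r hr => hradial _ (h.mem r hr) _ ((hφ' _ (h.mem r hr)).self_apply_inverse _)) hs
  · simpa only [h.source] using hvel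
  · rw [ContinuousLinearMap.bilinearComp_apply, (hφ' _ (h.mem r hr)).inverse_apply_self]
    exact h.hasDerivWithinAt_fderiv_velocity hr (hφ _ (h.mem r hr))

end IsGeodesic

namespace Deformation

variable {n : ℕ} {O : Set (Fin n → ℝ)} {x x' z : Fin n → ℝ} {D : Deformation O}

theorem contDiffAt_uncurry_H (D : Deformation O) (hO : IsOpen O) {s : Fin n → ℝ} (hx : x ∈ O)
    (hs : x + s ∈ O) : ContDiffAt ℝ ∞ (Function.uncurry D.H) (x, s) := by
  have hopen : IsOpen {p : (Fin n → ℝ) × (Fin n → ℝ) | p.1 ∈ O ∧ p.1 + p.2 ∈ O} :=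
    (hO.preimage continuous_fst).inter (hO.preimage (continuous_fst.add continuous_snd))
  exact D.smooth_H.contDiffAt (hopen.mem_nhds ⟨hx, hs⟩)

theorem contDiffAt_H (D : Deformation O) (hO : IsOpen O) {s : Fin n → ℝ} (hx : x ∈ O)
    (hs : x + s ∈ O) : ContDiffAt ℝ ∞ (D.H x) s :=
  (D.contDiffAt_uncurry_H hO hx hs).comp s (contDiffAt_const.prodMk contDiffAt_id)

theorem differentiableWithinAt_K (D : Deformation O) {s : Fin n → ℝ} (hx : x ∈ O)
    (hs : x + s ∈ O) :
    DifferentiableWithinAt ℝ (D.K x) (D.H x '' {r | x + r ∈ O}) (D.H x s) := by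
  have hK : DifferentiableWithinAt ℝ (fun p : (Fin n → ℝ) × (Fin n → ℝ) => D.K p.1 p.2)
      {p | p.1 ∈ O ∧ ∃ s, p.1 + s ∈ O ∧ D.H p.1 s = p.2} (x, D.H x s) :=
    (D.smooth_K (x, D.H x s) ⟨hx, s, hs, rfl⟩).differentiableWithinAt (by simp)
  refine hK.comp (D.H x s) (f := fun t => (x, t)) (by fun_prop) ?_
  rintro _ ⟨r, hr, rfl⟩
  exact ⟨hx, r, hr, rfl⟩

theorem isInvertible_fderiv_H (D : Deformation O) (hO : IsOpen O) {s : Fin n → ℝ} (hx : x ∈ O)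
    (hs : x + s ∈ O) : (fderiv ℝ (D.H x) s).IsInvertible :=
  isInvertible_of_leftInvOn
    ((D.contDiffAt_H hO hx hs).differentiableAt (by simp)).hasFDerivAt
    (preimage_add_left_mem_nhds hO hs) (D.differentiableWithinAt_K hx hs) (D.K_H x hx)

theorem vielbein_eq_inverse (D : Deformation O) (hO : IsOpen O) (hx : x ∈ O) :
    D.vielbein x = (fderiv ℝ (D.H x) 0).inverse := by
  have hx0 : x + 0 ∈ O := by rwa [add_zero]
  obtain ⟨e, he⟩ := D.isInvertible_fderiv_H hO hx hx0
  have hH : HasStrictFDerivAt (D.H x) (e : (Fin n → ℝ) →L[ℝ] (Fin n → ℝ)) 0 :=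
    he ▸ (D.contDiffAt_H hO hx hx0).hasStrictFDerivAt (by simp)
  have hK := hH.to_local_left_inverse
    (Filter.eventually_of_mem (preimage_add_left_mem_nhds hO hx0) (D.K_H x hx))
  rw [D.H_zero x hx] at hK
  rw [vielbein, hK.hasFDerivAt.fderiv, ← he, ContinuousLinearMap.inverse_equiv]

theorem isInvertible_vielbein (D : Deformation O) (hO : IsOpen O) (hx : x ∈ O) :
    (D.vielbein x).IsInvertible :=
  D.vielbein_eq_inverse hO hx ▸ (D.isInvertible_fderiv_H hO hx (by rwa [add_zero])).inverse

theorem contDiffAt_vielbein (D : Deformation O) (hO : IsOpen O) (hx : x ∈ O) :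
    ContDiffAt ℝ ∞ D.vielbein x := by
  have hx0 : x + 0 ∈ O := by rwa [add_zero]
  have hderiv : ContDiffAt ℝ ∞ (fun z => fderiv ℝ (D.H z) 0) x :=
    ContDiffAt.fderiv (g := fun _ => 0) (D.contDiffAt_uncurry_H hO hx hx0) contDiffAt_const
      (by simp)
  refine ((D.isInvertible_fderiv_H hO hx hx0).contDiffAt_map_inverse.comp x
    hderiv).congr_of_eventuallyEq ?_
  filter_upwards [hO.mem_nhds hx] with z hz using D.vielbein_eq_inverse hO hz

/-- The normal coordinates `H^μ(x, z - x)` of a point `z` with respect to the base point `x`. -/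
noncomputable def normalCoord (D : Deformation O) (x z : Fin n → ℝ) : Fin n → ℝ :=
  D.coordH x (z - x)

theorem fderiv_normalCoord (D : Deformation O) (x : Fin n → ℝ) :
    fderiv ℝ (D.normalCoord x) = D.transport x :=
  funext fun _ => fderiv_comp_sub x

theorem fderiv_transport_self (D : Deformation O) (x : Fin n → ℝ) :
    fderiv ℝ (D.transport x) x = D.Gam x :=
  (fderiv_comp_sub (f := fderiv ℝ (D.coordH x)) x).trans (by rw [sub_self, Gam])

theorem normalCoord_self (D : Deformation O) (hx : x ∈ O) : D.normalCoord x x = 0 := by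
  rw [normalCoord, coordH, sub_self, D.H_zero x hx, map_zero]

theorem injOn_normalCoord (D : Deformation O) (hO : IsOpen O) (hx : x ∈ O) :
    InjOn (D.normalCoord x) O := by
  have hmem : ∀ z ∈ O, x + (z - x) ∈ O := fun z hz => by rwa [add_sub_cancel]
  intro z hz w hw h
  have hH : D.H x (z - x) = D.H x (w - x) := (D.isInvertible_vielbein hO hx).injective h
  rw [← sub_left_inj (a := x), ← D.K_H x hx _ (hmem z hz), hH, D.K_H x hx _ (hmem w hw)]

theorem contDiffAt_uncurry_normalCoord (D : Deformation O) (hO : IsOpen O) (hx : x ∈ O)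
    (hz : z ∈ O) : ContDiffAt ℝ ∞ (Function.uncurry D.normalCoord) (x, z) := by
  have hH : ContDiffAt ℝ ∞ (fun p : (Fin n → ℝ) × (Fin n → ℝ) => D.H p.1 (p.2 - p.1)) (x, z) :=
    (D.contDiffAt_uncurry_H hO hx (by rwa [add_sub_cancel])).comp (x, z)
      (contDiffAt_fst.prodMk (contDiffAt_snd.sub contDiffAt_fst))
  exact ((D.contDiffAt_vielbein hO hx).comp (x, z) contDiffAt_fst).clm_apply hH

theorem contDiffAt_normalCoord (D : Deformation O) (hO : IsOpen O) (hx : x ∈ O) (hz : z ∈ O) :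
    ContDiffAt ℝ ∞ (D.normalCoord x) z :=
  (D.contDiffAt_uncurry_normalCoord hO hx hz).comp z (contDiffAt_const.prodMk contDiffAt_id)

theorem contDiffAt_two_normalCoord (D : Deformation O) (hO : IsOpen O) (hx : x ∈ O) (hz : z ∈ O) :
    ContDiffAt ℝ 2 (D.normalCoord x) z :=
  (D.contDiffAt_normalCoord hO hx hz).of_le (WithTop.coe_le_coe.2 le_top)

theorem differentiableAt_normalCoord (D : Deformation O) (hO : IsOpen O) (hx : x ∈ O)
    (hz : z ∈ O) : DifferentiableAt ℝ (D.normalCoord x) z :=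
  (D.contDiffAt_normalCoord hO hx hz).differentiableAt (by simp)

theorem contDiffAt_uncurry_transport (D : Deformation O) (hO : IsOpen O) (hx : x ∈ O)
    (hz : z ∈ O) : ContDiffAt ℝ ∞ (Function.uncurry D.transport) (x, z) := by
  have hcoord : ContDiffAt ℝ ∞ (Function.uncurry
      fun p : (Fin n → ℝ) × (Fin n → ℝ) => D.normalCoord p.1) ((x, z), z) :=
    (D.contDiffAt_uncurry_normalCoord hO hx hz).comp ((x, z), z)
      ((contDiffAt_fst.comp _ contDiffAt_fst).prodMk contDiffAt_snd)
  have h := ContDiffAt.fderiv (g := Prod.snd) (n := ∞) (m := ∞) hcoord contDiffAt_snd (by simp)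
  simpa only [Function.uncurry_def, fderiv_normalCoord] using h

theorem contDiffAt_Gam (D : Deformation O) (hO : IsOpen O) (hx : x ∈ O) :
    ContDiffAt ℝ ∞ D.Gam x := by
  have h := ContDiffAt.fderiv (g := id) (n := ∞) (m := ∞)
    (D.contDiffAt_uncurry_transport hO hx hx) contDiffAt_id (by simp)
  simpa only [id, fderiv_transport_self] using h

theorem isTorsionFreeConnection_Gam (D : Deformation O) (hO : IsOpen O) :
    IsTorsionFreeConnection O D.Gam where
  smooth x hx := (D.contDiffAt_Gam hO hx).contDiffWithinAt
  symm x hx u v := by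
    have h := (D.contDiffAt_two_normalCoord hO hx hx).isSymmSndFDerivAt (by simp)
    rw [IsSymmSndFDerivAt, fderiv_normalCoord, fderiv_transport_self] at h
    exact h u v

theorem transport_eq_vielbein_comp (D : Deformation O) (hO : IsOpen O) (hx : x ∈ O) (hz : z ∈ O) :
    D.transport x z = D.vielbein x ∘L fderiv ℝ (D.H x) (z - x) :=
  ((D.vielbein x).hasFDerivAt.comp (z - x) ((D.contDiffAt_H hO hx
    (by rwa [add_sub_cancel])).differentiableAt (by simp)).hasFDerivAt).fderiv

theorem isInvertible_transport (D : Deformation O) (hO : IsOpen O) (hx : x ∈ O) (hz : z ∈ O) :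
    (D.transport x z).IsInvertible :=
  D.transport_eq_vielbein_comp hO hx hz ▸
    (D.isInvertible_vielbein hO hx).comp (D.isInvertible_fderiv_H hO hx (by rwa [add_sub_cancel]))

theorem transport_self (D : Deformation O) (hO : IsOpen O) (hx : x ∈ O) :
    D.transport x x = .id ℝ (Fin n → ℝ) := by
  rw [D.transport_eq_vielbein_comp hO hx hx, sub_self, D.vielbein_eq_inverse hO hx,
    (D.isInvertible_fderiv_H hO hx (by rwa [add_zero])).inverse_comp_self]

namespace CanonicalAlong

variable {T T₁ T₂ : ℝ} {y y₁ y₂ τ τ₁ τ₂ : ℝ → Fin n → ℝ}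

theorem transport_source (h : D.CanonicalAlong x x' T y τ) {s : ℝ} (hs : s ∈ Icc 0 T) :
    D.transport x (y s) (τ s) = τ 0 := by
  rw [h.canonical 0 h.zero_mem s hs, h.source]

theorem normalCoord_eq_smul (h : D.CanonicalAlong x x' T y τ) (hO : IsOpen O) {s : ℝ}
    (hs : s ∈ Icc 0 T) : D.normalCoord x (y s) = s • τ 0 :=
  h.comp_eq_smul (fun _ hz => D.differentiableAt_normalCoord hO h.source_mem hz)
    (D.normalCoord_self h.source_mem)
    (fun _ hr => D.fderiv_normalCoord x ▸ h.transport_source hr) hs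

theorem normalCoord_target (h : D.CanonicalAlong x x' T y τ) (hO : IsOpen O) :
    D.normalCoord x x' = T • τ 0 :=
  h.target ▸ h.normalCoord_eq_smul hO h.length_mem

theorem differentiableWithinAt_velocity (h : D.CanonicalAlong x x' T y τ) (hO : IsOpen O) {s : ℝ}
    (hs : s ∈ Icc 0 T) : DifferentiableWithinAt ℝ τ (Icc 0 T) s := by
  have htransport : DifferentiableAt ℝ (fun z => D.transport z (y 0)) (y s) :=
    ((D.contDiffAt_uncurry_transport hO (h.mem s hs) (h.mem 0 h.zero_mem)).differentiableAt
      (by simp)).comp (g := Function.uncurry D.transport) (f := fun z => (z, y 0)) (y s)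
        (differentiableAt_id.prodMk (differentiableAt_const _))
  have hcomp := htransport.comp_differentiableWithinAt s (h.velocity s hs).differentiableWithinAt
  exact (hcomp.clm_apply (differentiableWithinAt_const (τ 0))).congr
    (fun r hr => h.canonical r hr 0 h.zero_mem) (h.canonical s hs 0 h.zero_mem)

theorem isGeodesic (h : D.CanonicalAlong x x' T y τ) (hO : IsOpen O) :
    IsGeodesic O D.Gam x x' T y τ where
  toIsCurve := h.toIsCurve
  geodesic s hs := by
    have hτ := (h.differentiableWithinAt_velocity hO hs).hasDerivWithinAt
    have hys := h.mem s hs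
    have hderiv := h.hasDerivWithinAt_fderiv_velocity hs
      (D.contDiffAt_two_normalCoord hO hys hys) hτ
    rw [fderiv_normalCoord, fderiv_transport_self, D.transport_self hO hys,
      ContinuousLinearMap.id_apply] at hderiv
    have hzero := eq_zero_of_hasDerivWithinAt_of_eqOn_const (uniqueDiffOn_Icc h.pos) hs hderiv
      fun r hr => (h.canonical s hs r hr).symm
    rwa [eq_neg_of_add_eq_zero_right hzero] at hτ

theorem unique (h₁ : D.CanonicalAlong x x' T₁ y₁ τ₁) (h₂ : D.CanonicalAlong x x' T₂ y₂ τ₂)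
    (hO : IsOpen O) {r : ℝ} (hr : r ∈ Icc (0 : ℝ) 1) : y₁ (T₁ * r) = y₂ (T₂ * r) := by
  have hmem : ∀ {T : ℝ}, 0 < T → T * r ∈ Icc 0 T := fun hT =>
    ⟨mul_nonneg hT.le hr.1, mul_le_of_le_one_right hT.le hr.2⟩
  have hcoord : ∀ {T : ℝ} {y τ : ℝ → Fin n → ℝ}, D.CanonicalAlong x x' T y τ →
      D.normalCoord x (y (T * r)) = r • D.normalCoord x x' := fun h => by
    rw [h.normalCoord_eq_smul hO (hmem h.pos), h.normalCoord_target hO, smul_smul, mul_comm]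
  exact D.injOn_normalCoord hO h₁.source_mem (h₁.mem _ (hmem h₁.pos)) (h₂.mem _ (hmem h₂.pos))
    ((hcoord h₁).trans (hcoord h₂).symm)

theorem covariantHessian_velocity (h : D.CanonicalAlong x x' T y τ) (hO : IsOpen O) {s : ℝ}
    (hs : s ∈ Icc 0 T) : covariantHessian D.Gam (D.normalCoord x) (y s) (τ s) (τ s) = 0 :=
  eq_zero_of_hasDerivWithinAt_of_eqOn_const (uniqueDiffOn_Icc h.pos) hs
    ((h.isGeodesic hO).hasDerivWithinAt_fderiv_velocity hs
      (D.contDiffAt_two_normalCoord hO h.source_mem (h.mem s hs)))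
    fun _ hr => D.fderiv_normalCoord x ▸ h.transport_source hr

end CanonicalAlong

namespace IsCanonical

variable {D₁ D₂ : Deformation O} {T : ℝ} {y τ : ℝ → Fin n → ℝ}

theorem covariantHessian_radial (hD : D.IsCanonical) (hO : IsOpen O) (hx : x ∈ O) (hz : z ∈ O)
    {w : Fin n → ℝ} (hw : D.transport x z w = D.normalCoord x z) :
    covariantHessian D.Gam (D.normalCoord x) z w w = 0 := by
  obtain ⟨T, y, τ, h⟩ := hD x hx z hz
  have hwτ : w = T • τ T := (D.isInvertible_transport hO hx hz).injective <| by
    rw [hw, map_smul, h.normalCoord_target hO, ← h.transport_source h.length_mem, h.target]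
  have hHess := h.covariantHessian_velocity hO h.length_mem
  rw [h.target] at hHess
  rw [hwτ, map_smul, map_smul, smul_apply, hHess, smul_zero, smul_zero]

theorem transport_source (hD : D.IsCanonical) (hO : IsOpen O)
    (h : IsGeodesic O D.Gam x x' T y τ) {s : ℝ} (hs : s ∈ Icc 0 T) :
    D.transport x (y s) (τ s) = τ 0 := by
  have hx := h.source_mem
  have hvel := h.fderiv_velocity_eq_of_radial (φ := D.normalCoord x)
    (fun z hz => (D.contDiffAt_Gam hO hz).continuousAt.continuousWithinAt)
    (fun z hz => D.contDiffAt_two_normalCoord hO hx hz)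
    (fun z hz => D.fderiv_normalCoord x ▸ D.isInvertible_transport hO hx hz)
    (D.normalCoord_self hx)
    (fun z hz w hw => hD.covariantHessian_radial hO hx hz (D.fderiv_normalCoord x ▸ hw)) hs
  rwa [fderiv_normalCoord, D.transport_self hO hx, ContinuousLinearMap.id_apply] at hvel

theorem transport_velocity (hD : D.IsCanonical) (hO : IsOpen O)
    (h : IsGeodesic O D.Gam x x' T y τ) {s₀ s : ℝ} (hs₀ : s₀ ∈ Icc 0 T) (hs : s ∈ Icc 0 T) :
    D.transport (y s₀) (y s) (τ s) = τ s₀ := by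
  rcases eq_or_ne s s₀ with rfl | hne
  · rw [D.transport_self hO (h.mem _ hs), ContinuousLinearMap.id_apply]
  · have hsegment := hD.transport_source hO (h.comp_lineMap hs₀ hs) (right_mem_Icc.2 zero_le_one)
    rw [AffineMap.lineMap_apply_one, AffineMap.lineMap_apply_zero, map_smul] at hsegment
    exact smul_right_injective _ (sub_ne_zero.2 hne) hsegment

theorem canonicalAlong (hD : D.IsCanonical) (hO : IsOpen O)
    (h : IsGeodesic O D.Gam x x' T y τ) : D.CanonicalAlong x x' T y τ where
  toIsCurve := h.toIsCurve
  canonical _ hs _ hs' := (hD.transport_velocity hO h hs hs').symm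

theorem normalCoord_eq_of_Gam_eq (h₁ : D₁.IsCanonical) (h₂ : D₂.IsCanonical) (hO : IsOpen O)
    (hΓ : ∀ z ∈ O, D₁.Gam z = D₂.Gam z) (hx : x ∈ O) (hz : z ∈ O) :
    D₁.normalCoord x z = D₂.normalCoord x z := by
  obtain ⟨T, y, τ, hc₁⟩ := h₁ x hx z hz
  have hc₂ := h₂.canonicalAlong hO ((hc₁.isGeodesic hO).congr hΓ)
  rw [hc₁.normalCoord_target hO, hc₂.normalCoord_target hO]

end IsCanonical

end Deformation

theorem proposition1 {n : ℕ} (O : Set (Fin n → ℝ)) (hO : IsOpen O) :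
    -- (a)
    (∀ D : Deformation O,
      IsTorsionFreeConnection O D.Gam ∧
      -- a curve along which the condition of canonicity holds is a geodesic
      (∀ x x' T y τ, D.CanonicalAlong x x' T y τ → IsGeodesic O D.Gam x x' T y τ) ∧
      -- and is determined by its end points, up to the choice of the length `T` of the interval
      (∀ x x' T₁ y₁ τ₁ T₂ y₂ τ₂,
        D.CanonicalAlong x x' T₁ y₁ τ₁ → D.CanonicalAlong x x' T₂ y₂ τ₂ →
          ∀ r ∈ Icc (0 : ℝ) 1, y₁ (T₁ * r) = y₂ (T₂ * r)) ∧
      -- if the deformation is canonical, it is even the only geodesic in `O` with these end points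
      (D.IsCanonical → ∀ x x' T₁ y₁ τ₁ T₂ y₂ τ₂,
        D.CanonicalAlong x x' T₁ y₁ τ₁ → IsGeodesic O D.Gam x x' T₂ y₂ τ₂ →
          ∀ r ∈ Icc (0 : ℝ) 1, y₁ (T₁ * r) = y₂ (T₂ * r))) ∧
    -- (b)
    (∀ D₁ D₂ : Deformation O, D₁.IsCanonical → D₂.IsCanonical →
      (∀ x ∈ O, D₁.Gam x = D₂.Gam x) →
        ∀ x ∈ O, ∀ s, x + s ∈ O → D₁.coordH x s = D₂.coordH x s) ∧
    (∀ D : Deformation O, D.IsCanonical →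
      -- the derivatives of `H^μ(p, · - p)` along a geodesic through `p` are constant, equal to the
      -- velocity at `p`
      (∀ x x' T y τ, IsGeodesic O D.Gam x x' T y τ →
        ∀ s₀ ∈ Icc 0 T, ∀ s ∈ Icc 0 T,
          HasDerivWithinAt (fun s' => D.coordH (y s₀) (y s' - y s₀))
            (D.transport (y s₀) (y s) (τ s)) (Icc 0 T) s ∧
          D.transport (y s₀) (y s) (τ s) = τ s₀) ∧
      -- and these first integrals are independent
      (∀ x ∈ O, ∀ x' ∈ O, Function.Bijective (D.transport x x'))) := by
  refine ⟨fun D => ⟨D.isTorsionFreeConnection_Gam hO, fun _ _ _ _ _ h => h.isGeodesic hO,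
    fun _ _ _ _ _ _ _ _ h₁ h₂ _ hr => h₁.unique h₂ hO hr,
    fun hD _ _ _ _ _ _ _ _ h₁ h₂ _ hr => h₁.unique (hD.canonicalAlong hO h₂) hO hr⟩,
    fun D₁ D₂ h₁ h₂ hΓ x hx s hs => ?_,
    fun D hD => ⟨fun x x' T y τ h s₀ hs₀ s hs => ⟨?_, hD.transport_velocity hO h hs₀ hs⟩,
      fun x hx x' hx' => (D.isInvertible_transport hO hx hx').bijective⟩⟩
  · simpa only [Deformation.normalCoord, add_sub_cancel_left] using
      h₁.normalCoord_eq_of_Gam_eq h₂ hO hΓ hx hs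
  · rw [← D.fderiv_normalCoord (y s₀)]
    exact h.hasDerivWithinAt_comp hs
      (D.differentiableAt_normalCoord hO (h.mem s₀ hs₀) (h.mem s hs))
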